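/- Let $d\ge 2$ and $N\ge 1$ be integers. For a finite set $S\subset\mathbb R^d$ and an integer $k$ with $1\le k\le|S|$, let $K_k(S)$ be the convex hull of the set of centroids $\frac1k\sum_{i=1}^k s_i$ of $k$ distinct points $s_1,\dots,s_k$ of $S$. Let $p_1,\dots,p_N$ be independent random points, uniformly distributed on the unit sphere $\mathcal S^{d-1}\subset\mathbb R^d$, put $P=\{p_1,\dots,p_N\}$, and let $$L_N^d := K_N\bigl(P\cup(-P)\bigr)$$ be the (random) halving polyhedron of $P\cup(-P)$, which almost surely has exactly $2N$ points. Let $m_d:=\mathbb E\,|X\cdot u|$, where $X$ is uniformly distributed on $\mathcal S^{d-1}$ and $u$ is a unit vector (the value does not depend on $u$). There is an absolute constant $c>0$, independent of $d$, $N$ and $\eta$, such that for all such $d$ and $N$ and for every $\eta>0$, the inequality $$\mathrm d_{\mathrm H}\Bigl(\tfrac1{m_d}L_N^d,\ \mathcal B(0,1)\Bigr)\le\eta$$ holds with probability at least $$1-2\exp\bigl[c\,\bigl(d\log(1/\delta)-N\eta^2\bigr)\bigr],\qquad \delta=\min\bigl(\eta,1/\sqrt d\bigr),$$ where $\mathrm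 d_{\mathrm H}$ is the Hausdorff distance and $\mathcal B(0,1)$ is the closed unit ball of $\mathbb R^d$. -/

import Mathlib

open MeasureTheory ProbabilityTheory
open scoped Pointwise RealInnerProductSpace

/-- The uniform probability measure on the unit sphere `S^{d-1}` of `ℝ^d`: the surface measure
induced by Lebesgue measure, normalized to total mass one. -/
noncomputable def uniformSphere (d : ℕ) :
    Measure (Metric.sphere (0 : EuclideanSpace ℝ (Fin d)) 1) :=
  ((volume : Measure (EuclideanSpace ℝ (Fin d))).toSphere Set.univ)⁻¹ •
    (volume : Measure (EuclideanSpace ℝ (Fin d))).toSphere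

/-- The mean `E |X · u|` for `X` uniformly distributed on the unit sphere of `ℝ^d`. For unit
vectors `u` its value, denoted `m_d`, is the same for all `u`. -/
noncomputable def sphereMeanAbs (d : ℕ) (u : EuclideanSpace ℝ (Fin d)) : ℝ :=
  ∫ x, |⟪(x : EuclideanSpace ℝ (Fin d)), u⟫| ∂(uniformSphere d)

/-- The set of centroids of `k` distinct points of `S`. -/
def kCentroids {d : ℕ} (k : ℕ) (S : Set (EuclideanSpace ℝ (Fin d))) :
    Set (EuclideanSpace ℝ (Fin d)) :=
  {q | ∃ T : Finset (EuclideanSpace ℝ (Fin d)),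
    (T : Set (EuclideanSpace ℝ (Fin d))) ⊆ S ∧ T.card = k ∧ q = (k : ℝ)⁻¹ • ∑ p ∈ T, p}

/-- The `k`-set polyhedron of `S`: the convex hull of the centroids of `k` distinct points
of `S`. -/
def kSetPolyhedron {d : ℕ} (k : ℕ) (S : Set (EuclideanSpace ℝ (Fin d))) :
    Set (EuclideanSpace ℝ (Fin d)) :=
  convexHull ℝ (kCentroids k S)

/-- The halving polyhedron `L_N^d(P)` of the symmetrization `P ∪ (-P)` of a set `P` of `N`
points. -/
def symHalvingPolyhedron {d : ℕ} (N : ℕ) (P : Set (EuclideanSpace ℝ (Fin d))) :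
    Set (EuclideanSpace ℝ (Fin d)) :=
  kSetPolyhedron N (P ∪ -P)

/-! ### Support functions and Hausdorff distance -/

section Geometry

/-! For distinct, pairwise non-antipodal points, the support function of the halving polyhedron in
direction v is (1/N) ∑ |⟪p i, v⟫|: an optimal choice of N points takes from each pair ±p i the one
on the positive side of v. For unit v its mean is m_d. Uniform closeness of support functions on
unit vectors controls the Hausdorff distance of convex bodies, so it suffices to bound Y v = ∑ (|⟪p
i, v⟫| / m_d - ‖v‖) by N η uniformly on the unit ball.

The increments of Y are subgaussian at scale ‖v - w‖, with a dimension-free constant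
(`hasSubgaussianMGF_abs_inner_sub`). Indeed a Gaussian vector is a uniform sphere point times an
independent radius of mean ρ. Jensen in the radius bounds the exponential moments of ρ ⟪X, v⟫ by
Gaussian ones, and m_d ρ = E|g| for a standard Gaussian g. Symmetrization and the 1-Lipschitz
property of |·| pass from linear forms to their absolute values.

Chaining along dyadic nets (`measure_exists_lt_abs_le_of_subgaussian_increments`) bounds the failure
probability by 2 exp(6d - b N η²) with b absolute. Since log(1/δ) ≥ (log d)/2,
`exists_common_constant` brings this to the form with a single constant c. -/

lemma inner_le_of_mem_kCentroids {d N : ℕ} {p : Fin N → EuclideanSpace ℝ (Fin d)}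
    {q : EuclideanSpace ℝ (Fin d)} (hq : q ∈ kCentroids N (Set.range p ∪ -Set.range p))
    (v : EuclideanSpace ℝ (Fin d)) :
    ⟪q, v⟫ ≤ (N : ℝ)⁻¹ * ∑ i, |⟪p i, v⟫| := by
  classical
  obtain ⟨T, hT, -, rfl⟩ := hq
  rw [real_inner_smul_left, sum_inner]
  refine mul_le_mul_of_nonneg_left ?_ (by positivity)
  have hsub : T ⊆ Finset.univ.image p ∪ Finset.univ.image (-p) := by
    intro x hx
    rcases hT hx with ⟨i, rfl⟩ | ⟨i, hi⟩
    · simp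
    · simp only [Finset.mem_union, Finset.mem_image, Finset.mem_univ, true_and, Pi.neg_apply]
      exact Or.inr ⟨i, by simp [hi]⟩
  -- Points may coincide here; grouping indices by their value costs nothing because positive parts
  -- are nonnegative.
  have himage (f : Fin N → EuclideanSpace ℝ (Fin d)) :
      ∑ t ∈ Finset.univ.image f, max ⟪t, v⟫ 0 ≤ ∑ i, max ⟪f i, v⟫ 0 := by
    rw [← Finset.sum_fiberwise_of_maps_to (s := Finset.univ) (t := Finset.univ.image f) (g := f)
      (fun i _ => Finset.mem_image_of_mem f (Finset.mem_univ i))]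
    refine Finset.sum_le_sum fun t ht => ?_
    obtain ⟨i, -, rfl⟩ := Finset.mem_image.1 ht
    exact Finset.single_le_sum (f := fun j => max ⟪f j, v⟫ 0) (fun j _ => le_max_right _ _)
      (by simp : i ∈ Finset.univ.filter fun j => f j = f i)
  calc ∑ t ∈ T, ⟪t, v⟫ ≤ ∑ t ∈ T, max ⟪t, v⟫ 0 := Finset.sum_le_sum fun _ _ => le_max_left _ _
    _ ≤ ∑ t ∈ Finset.univ.image p ∪ Finset.univ.image (-p), max ⟪t, v⟫ 0 :=
        Finset.sum_le_sum_of_subset_of_nonneg hsub fun _ _ _ => le_max_right _ _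
    _ ≤ ∑ t ∈ Finset.univ.image p, max ⟪t, v⟫ 0 + ∑ t ∈ Finset.univ.image (-p), max ⟪t, v⟫ 0 := by
        rw [← Finset.sum_union_inter]
        exact le_add_of_nonneg_right (Finset.sum_nonneg fun _ _ => le_max_right _ _)
    _ ≤ ∑ i, max ⟪p i, v⟫ 0 + ∑ i, max ⟪(-p) i, v⟫ 0 := add_le_add (himage _) (himage _)
    _ = ∑ i, |⟪p i, v⟫| := by
        rw [← Finset.sum_add_distrib]
        refine Finset.sum_congr rfl fun i _ => ?_
        rw [Pi.neg_apply, inner_neg_left]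
        rcases le_total 0 ⟪p i, v⟫ with h | h
        · rw [abs_of_nonneg h, max_eq_left h, max_eq_right (by linarith)]; ring
        · rw [abs_of_nonpos h, max_eq_right h, max_eq_left (by linarith)]; ring

/-- Choose the sign of each p i that makes its product with v nonnegative. The hypothesis keeps the
N chosen points distinct, so they form an admissible N-subset. -/
lemma exists_mem_kCentroids_inner_eq {d N : ℕ} {p : Fin N → EuclideanSpace ℝ (Fin d)}
    (hp : ∀ i j, i ≠ j → p i ≠ p j ∧ p i ≠ -p j) (v : EuclideanSpace ℝ (Fin d)) :
    ∃ q ∈ kCentroids N (Set.range p ∪ -Set.range p),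
      ⟪q, v⟫ = (N : ℝ)⁻¹ * ∑ i, |⟪p i, v⟫| := by
  classical
  let s : Fin N → EuclideanSpace ℝ (Fin d) := fun i => if 0 ≤ ⟪p i, v⟫ then p i else -p i
  have hs : Function.Injective s := by
    intro i j hij
    by_contra hne
    obtain ⟨h1, h2⟩ := hp i j hne
    simp only [s] at hij
    split_ifs at hij
    · exact h1 hij
    · exact h2 hij
    · exact h2 (neg_eq_iff_eq_neg.1 hij)
    · exact h1 (neg_injective hij)
  refine ⟨_, ⟨Finset.univ.image s, ?_, ?_, rfl⟩, ?_⟩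
  · intro x hx
    simp only [Finset.coe_image, Finset.coe_univ, Set.image_univ] at hx
    obtain ⟨i, rfl⟩ := hx
    simp only [s]
    split_ifs
    · exact Or.inl ⟨i, rfl⟩
    · exact Or.inr ⟨i, by simp⟩
  · rw [Finset.card_image_of_injective _ hs]; simp
  · rw [real_inner_smul_left, sum_inner, Finset.sum_image fun i _ j _ h => hs h]
    congr 1
    refine Finset.sum_congr rfl fun i _ => ?_
    simp only [s]
    split_ifs with h
    · rw [abs_of_nonneg h]
    · rw [abs_of_neg (not_le.1 h), inner_neg_left]

lemma finite_kCentroids {d : ℕ} (k : ℕ) {S : Set (EuclideanSpace ℝ (Fin d))} (hS : S.Finite) :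
    (kCentroids k S).Finite := by
  refine (hS.finite_subsets.preimage (Finset.coe_injective.injOn) |>.image
    fun T : Finset (EuclideanSpace ℝ (Fin d)) => (k : ℝ)⁻¹ • ∑ p ∈ T, p).subset ?_
  rintro q ⟨T, hT, -, rfl⟩
  exact ⟨T, hT, rfl⟩

/-- A point x of K outside the ball is moved radially to the sphere; the upper bound in direction
x/‖x‖ controls the move. For x in the ball with nearest point y in K, the direction of x - y is an
outer normal of K at y, so the lower bound there limits ‖x - y‖. -/
lemma hausdorffEDist_closedBall_le_of_support {F : Type*} [NormedAddCommGroup F]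
    [InnerProductSpace ℝ F] {K : Set F} (hK : IsCompact K) (hconv : Convex ℝ K)
    (hne : K.Nonempty) {η : ℝ} (hη : 0 ≤ η)
    (hupper : ∀ v : F, ‖v‖ = 1 → ∀ x ∈ K, ⟪x, v⟫ ≤ 1 + η)
    (hlower : ∀ v : F, ‖v‖ = 1 → ∃ x ∈ K, 1 - η ≤ ⟪x, v⟫) :
    Metric.hausdorffEDist K (Metric.closedBall 0 1) ≤ ENNReal.ofReal η := by
  refine Metric.hausdorffEDist_le_of_mem_edist (fun x hx => ?_) (fun x hx => ?_)
  · by_cases h1 : ‖x‖ ≤ 1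
    · exact ⟨x, by simpa using h1, by simp⟩
    · have h1' : 1 < ‖x‖ := not_le.1 h1
      have hx0 : ‖x‖ ≠ 0 := by linarith
      have hn : ‖‖x‖⁻¹ • x‖ = 1 := by rw [norm_smul, norm_inv, norm_norm, inv_mul_cancel₀ hx0]
      refine ⟨‖x‖⁻¹ • x, by simp [hn], ?_⟩
      rw [edist_dist]
      refine ENNReal.ofReal_le_ofReal ?_
      have := hupper _ hn x hx
      rw [real_inner_smul_right, real_inner_self_eq_norm_mul_norm, ← mul_assoc,
        inv_mul_cancel₀ hx0, one_mul] at this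
      have e : x - ‖x‖⁻¹ • x = (1 - ‖x‖⁻¹) • x := by rw [sub_smul, one_smul]
      rw [dist_eq_norm, e, norm_smul, Real.norm_of_nonneg (sub_nonneg.2 (inv_le_one_of_one_le₀ h1'.le)),
        sub_mul, inv_mul_cancel₀ hx0]
      linarith
  · obtain ⟨y, hy, hmin⟩ := exists_norm_eq_iInf_of_complete_convex hne hK.isComplete hconv x
    have hproj := (norm_eq_iInf_iff_real_inner_le_zero hconv hy).1 hmin
    refine ⟨y, hy, ?_⟩
    rw [edist_dist, dist_eq_norm]
    refine ENNReal.ofReal_le_ofReal ?_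
    by_cases h0 : ‖x - y‖ = 0
    · rwa [h0]
    have hpos : 0 < ‖x - y‖ := lt_of_le_of_ne (norm_nonneg _) (Ne.symm h0)
    have hn : ‖‖x - y‖⁻¹ • (x - y)‖ = 1 := by rw [norm_smul, norm_inv, norm_norm, inv_mul_cancel₀ h0]
    obtain ⟨w, hw, hwv⟩ := hlower _ hn
    have hxv : ⟪x, ‖x - y‖⁻¹ • (x - y)⟫ ≤ 1 := by
      refine (real_inner_le_norm _ _).trans ?_
      rw [hn, mul_one]
      simpa using hx
    have e1 : ⟪x, ‖x - y‖⁻¹ • (x - y)⟫ - ⟪y, ‖x - y‖⁻¹ • (x - y)⟫ = ‖x - y‖ := by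
      rw [← inner_sub_left, real_inner_smul_right, real_inner_self_eq_norm_mul_norm, ← mul_assoc,
        inv_mul_cancel₀ h0, one_mul]
    have e2 : ⟪w, ‖x - y‖⁻¹ • (x - y)⟫ - ⟪y, ‖x - y‖⁻¹ • (x - y)⟫ ≤ 0 := by
      rw [← inner_sub_left, real_inner_smul_right, real_inner_comm]
      exact mul_nonpos_of_nonneg_of_nonpos (by positivity) (hproj w hw)
    linarith

lemma hausdorffEDist_symHalvingPolyhedron_le {d N : ℕ} {p : Fin N → EuclideanSpace ℝ (Fin d)}
    (hp : ∀ i j, i ≠ j → p i ≠ p j ∧ p i ≠ -p j) {m η : ℝ} (hm : 0 < m) (hη : 0 ≤ η)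
    (h : ∀ v : EuclideanSpace ℝ (Fin d), ‖v‖ = 1 →
      |m⁻¹ * ((N : ℝ)⁻¹ * ∑ i, |⟪p i, v⟫|) - 1| ≤ η) :
    Metric.hausdorffEDist (m⁻¹ • symHalvingPolyhedron N (Set.range p)) (Metric.closedBall 0 1) ≤
      ENNReal.ofReal η := by
  have hfin : (kCentroids N (Set.range p ∪ -Set.range p)).Finite := by
    refine finite_kCentroids N ((Set.finite_range p).union ?_)
    rw [← Set.image_neg_eq_neg]
    exact (Set.finite_range p).image _
  obtain ⟨q₀, hq₀, -⟩ := exists_mem_kCentroids_inner_eq hp 0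
  refine hausdorffEDist_closedBall_le_of_support ((hfin.isCompact_convexHull (𝕜 := ℝ)).smul _)
    ((convex_convexHull ℝ _).smul _)
    (Set.Nonempty.smul_set ⟨q₀, subset_convexHull ℝ _ hq₀⟩) hη (fun v hv x hx => ?_)
    (fun v hv => ?_)
  · obtain ⟨y, hy, rfl⟩ := Set.mem_smul_set.1 hx
    have hy' : ⟪y, v⟫ ≤ (N : ℝ)⁻¹ * ∑ i, |⟪p i, v⟫| := by
      have hc : Convex ℝ {z : EuclideanSpace ℝ (Fin d) | ⟪z, v⟫ ≤ (N : ℝ)⁻¹ * ∑ i, |⟪p i, v⟫|} :=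
        convex_halfSpace_le ⟨fun a b => inner_add_left a b v,
          fun c a => real_inner_smul_left a v c⟩ _
      exact convexHull_min (fun q hq => inner_le_of_mem_kCentroids hq v) hc hy
    rw [real_inner_smul_left]
    have := mul_le_mul_of_nonneg_left hy' (inv_nonneg.2 hm.le)
    linarith [(abs_le.1 (h v hv)).2]
  · obtain ⟨q, hq, hqv⟩ := exists_mem_kCentroids_inner_eq hp v
    refine ⟨m⁻¹ • q, Set.smul_mem_smul_set (subset_convexHull ℝ _ hq), ?_⟩
    rw [real_inner_smul_left, hqv]
    linarith [(abs_le.1 (h v hv)).1]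

end Geometry

/-! ### Uniform law on the sphere as the angular part of a Gaussian -/

section SphereLaw

lemma nontrivial_euclideanSpace {d : ℕ} (hd : 1 ≤ d) : Nontrivial (EuclideanSpace ℝ (Fin d)) := by
  have : NeZero d := ⟨by omega⟩
  infer_instance

lemma toSphere_univ_ne_zero {d : ℕ} (hd : 1 ≤ d) :
    (volume : Measure (EuclideanSpace ℝ (Fin d))).toSphere Set.univ ≠ 0 := by
  have := nontrivial_euclideanSpace hd
  exact Measure.measure_univ_ne_zero.2 (Measure.toSphere_ne_zero _)

lemma isProbabilityMeasure_uniformSphere {d : ℕ} (hd : 1 ≤ d) :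
    IsProbabilityMeasure (uniformSphere d) where
  measure_univ := by
    rw [uniformSphere, Measure.smul_apply, smul_eq_mul,
      ENNReal.inv_mul_cancel (toSphere_univ_ne_zero hd) (measure_ne_top _ _)]

/-- Surface measure is proportional to the volume of the cone over a set, and the cone over a point
lies in a line, which is null for d ≥ 2. -/
lemma uniformSphere_singleton {d : ℕ} (hd : 2 ≤ d)
    (x : Metric.sphere (0 : EuclideanSpace ℝ (Fin d)) 1) : uniformSphere d {x} = 0 := by
  have hspan : (volume : Measure (EuclideanSpace ℝ (Fin d)))
      (Submodule.span ℝ {(x : EuclideanSpace ℝ (Fin d))} : Set (EuclideanSpace ℝ (Fin d))) = 0 := by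
    refine Measure.addHaar_submodule _ _ fun h => ?_
    have h1 := finrank_span_singleton (K := ℝ) (ne_zero_of_mem_unit_sphere x)
    rw [h, finrank_top, finrank_euclideanSpace_fin] at h1
    omega
  rw [uniformSphere, Measure.smul_apply, Measure.toSphere_apply' _ (measurableSet_singleton x)]
  rw [measure_mono_null _ hspan]
  · simp
  · rintro y ⟨r, -, z, hz, rfl⟩
    simp only [Set.image_singleton, Set.mem_singleton_iff] at hz
    subst hz
    exact Submodule.smul_mem _ _ (Submodule.mem_span_singleton_self _)

/-- The density of the standard Gaussian distribution on `ℝ^d` as a function of the norm. -/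
noncomputable def gaussianRadialDensity (d : ℕ) (r : ℝ) : ℝ :=
  ((Real.pi / (1 / 2)) ^ (d / 2 : ℝ))⁻¹ * Real.exp (-(1 / 2) * r ^ 2)

/-- The standard Gaussian distribution on `ℝ^d`, given by its density. -/
noncomputable def gaussianEuclidean (d : ℕ) : Measure (EuclideanSpace ℝ (Fin d)) :=
  volume.withDensity fun x => ENNReal.ofReal (gaussianRadialDensity d ‖x‖)

lemma gaussianRadialDensity_nonneg (d : ℕ) (r : ℝ) : 0 ≤ gaussianRadialDensity d r := by
  unfold gaussianRadialDensity; positivity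

lemma continuous_gaussianRadialDensity (d : ℕ) : Continuous (gaussianRadialDensity d) := by
  unfold gaussianRadialDensity; fun_prop

instance (d : ℕ) : IsProbabilityMeasure (gaussianEuclidean d) where
  measure_univ := by
    have hI := GaussianFourier.integral_rexp_neg_mul_sq_norm (V := EuclideanSpace ℝ (Fin d))
      (b := 1 / 2) (by norm_num)
    rw [finrank_euclideanSpace_fin] at hI
    have hpos : (0 : ℝ) < (Real.pi / (1 / 2)) ^ (d / 2 : ℝ) := by positivity
    -- A non-integrable function would have integral 0 by convention, but `hI` gives a positive
    -- value.
    have hint : Integrable fun v : EuclideanSpace ℝ (Fin d) => Real.exp (-(1 / 2) * ‖v‖ ^ 2) := by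
      by_contra h
      rw [integral_undef h] at hI
      exact hpos.ne hI
    rw [gaussianEuclidean, withDensity_apply _ MeasurableSet.univ, Measure.restrict_univ]
    simp only [gaussianRadialDensity]
    rw [← ofReal_integral_eq_lintegral_ofReal (hint.const_mul _)
        (Filter.Eventually.of_forall fun x => gaussianRadialDensity_nonneg d ‖x‖),
      integral_const_mul, hI, inv_mul_cancel₀ hpos.ne', ENNReal.ofReal_one]

lemma charFun_gaussianEuclidean (d : ℕ) (t : EuclideanSpace ℝ (Fin d)) :
    charFun (gaussianEuclidean d) t = Complex.exp (-(‖t‖ : ℂ) ^ 2 / 2) := by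
  have hI := GaussianFourier.integral_cexp_neg_mul_sq_norm_add (V := EuclideanSpace ℝ (Fin d))
    (b := 1 / 2) (by norm_num) Complex.I t
  rw [finrank_euclideanSpace_fin] at hI
  have hpos : (0 : ℝ) < (Real.pi / (1 / 2)) ^ (d / 2 : ℝ) := by positivity
  have hcast : ((Real.pi : ℂ) / (1 / 2)) ^ (d / 2 : ℂ) =
      (((Real.pi / (1 / 2)) ^ (d / 2 : ℝ) : ℝ) : ℂ) := by
    rw [Complex.ofReal_cpow (by positivity)]
    push_cast
    rfl
  have hmeas : Measurable fun x : EuclideanSpace ℝ (Fin d) =>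
      ENNReal.ofReal (gaussianRadialDensity d ‖x‖) :=
    ((continuous_gaussianRadialDensity d).comp continuous_norm).measurable.ennreal_ofReal
  rw [charFun_apply, gaussianEuclidean, integral_withDensity_eq_integral_toReal_smul hmeas
    (Filter.Eventually.of_forall fun _ => ENNReal.ofReal_lt_top)]
  have key : ∀ x : EuclideanSpace ℝ (Fin d),
      (ENNReal.ofReal (gaussianRadialDensity d ‖x‖)).toReal • Complex.exp (⟪x, t⟫ * Complex.I) =
      ((((Real.pi / (1 / 2)) ^ (d / 2 : ℝ) : ℝ) : ℂ))⁻¹ *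
        Complex.exp (-(1 / 2) * ‖x‖ ^ 2 + Complex.I * ⟪t, x⟫) := by
    intro x
    rw [ENNReal.toReal_ofReal (gaussianRadialDensity_nonneg d _), gaussianRadialDensity,
      Complex.real_smul, Complex.exp_add, real_inner_comm]
    push_cast
    ring_nf
  simp_rw [key]
  rw [integral_const_mul, hI, hcast, ← mul_assoc,
    inv_mul_cancel₀ (Complex.ofReal_ne_zero.2 hpos.ne'), one_mul, Complex.I_sq]
  congr 1
  ring

lemma map_inner_gaussianEuclidean {d : ℕ} {u : EuclideanSpace ℝ (Fin d)} (hu : ‖u‖ = 1) :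
    (gaussianEuclidean d).map (fun x => ⟪x, u⟫) = gaussianReal 0 1 := by
  have hmeas : Measurable fun x : EuclideanSpace ℝ (Fin d) => ⟪x, u⟫ := by fun_prop
  have := Measure.isProbabilityMeasure_map (μ := gaussianEuclidean d) hmeas.aemeasurable
  refine Measure.ext_of_charFun (funext fun s => ?_)
  have h := charFun_gaussianEuclidean d (s • u)
  rw [charFun_apply] at h
  rw [charFun_gaussianReal, charFun_apply, integral_map hmeas.aemeasurable
    (by fun_prop : Continuous _).aestronglyMeasurable]
  simp only [real_inner_smul_right] at h
  rw [norm_smul, hu, mul_one] at h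
  have h2 : ((‖s‖ : ℝ) : ℂ) ^ 2 = (s : ℂ) ^ 2 := by
    rw [← Complex.ofReal_pow, Real.norm_eq_abs, sq_abs, Complex.ofReal_pow]
  rw [h2] at h
  simp only [RCLike.inner_apply, conj_trivial]
  refine h.trans ?_
  congr 1
  simp
  ring

/-- Polar coordinates: the Gaussian density depends only on the norm, so it enters the radial factor
alone. -/
lemma map_smul_uniformSphere_prod {d : ℕ} (hd : 1 ≤ d) :
    ∃ ν : Measure (Set.Ioi (0 : ℝ)), IsProbabilityMeasure ν ∧
      ((uniformSphere d).prod ν).map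
        (fun z => (z.2 : ℝ) • (z.1 : EuclideanSpace ℝ (Fin d))) = gaussianEuclidean d := by
  have := nontrivial_euclideanSpace hd
  have := isProbabilityMeasure_uniformSphere hd
  let E := EuclideanSpace ℝ (Fin d)
  let τ := (volume : Measure E).toSphere
  let κ := Measure.volumeIoiPow (Module.finrank ℝ E - 1)
  let g : ℝ → ENNReal := fun r => ENNReal.ofReal (gaussianRadialDensity d r)
  have hg : Measurable g := (continuous_gaussianRadialDensity d).measurable.ennreal_ofReal
  -- The total mass of the surface measure moves into ν, compensating the normalization of
  -- `uniformSphere`.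
  let ν : Measure (Set.Ioi (0 : ℝ)) := (τ Set.univ) • κ.withDensity (fun r => g r)
  have hc0 : τ Set.univ ≠ 0 := toSphere_univ_ne_zero hd
  have hc : τ Set.univ ≠ ⊤ := measure_ne_top _ _
  have hprod : (uniformSphere d).prod ν = (τ.prod κ).withDensity (fun z => g z.2) := by
    have : uniformSphere d = (τ Set.univ)⁻¹ • τ := rfl
    rw [this, Measure.prod_smul_left, Measure.prod_smul_right, smul_smul,
      ENNReal.inv_mul_cancel hc0 hc, one_smul, prod_withDensity_right]
    exact hg.comp measurable_subtype_coe
  have hsm : Measurable (fun z : Metric.sphere (0 : E) 1 × Set.Ioi (0 : ℝ) =>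
      (z.2 : ℝ) • (z.1 : E)) := by fun_prop
  have hmap : ((uniformSphere d).prod ν).map (fun z => (z.2 : ℝ) • (z.1 : E)) =
      gaussianEuclidean d := by
    refine Measure.ext_of_lintegral _ fun f hf => ?_
    have hw₁ : Measurable fun z : Metric.sphere (0 : E) 1 × Set.Ioi (0 : ℝ) => g z.2 :=
      hg.comp (measurable_subtype_coe.comp measurable_snd)
    have hw₂ : Measurable fun x : E => g ‖x‖ := hg.comp measurable_norm
    have hfs : Measurable fun z : Metric.sphere (0 : E) 1 × Set.Ioi (0 : ℝ) =>
        f ((z.2 : ℝ) • (z.1 : E)) := hf.comp hsm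
    rw [lintegral_map hf hsm, hprod, lintegral_withDensity_eq_lintegral_mul _ hw₁ hfs]
    refine Eq.trans ?_ (lintegral_withDensity_eq_lintegral_mul volume hw₂ hf).symm
    have hmp := (volume : Measure E).measurePreserving_homeomorphUnitSphereProd
    rw [← hmp.lintegral_comp_emb (Homeomorph.measurableEmbedding _)]
    have h0 : ∫⁻ x, ((fun x : E => g ‖x‖) * f) x ∂volume =
        ∫⁻ x : ({0}ᶜ : Set E), ((fun x : E => g ‖x‖) * f) (x : E) ∂(volume.comap Subtype.val) := by
      rw [lintegral_subtype_comap (measurableSet_singleton _).compl,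
        restrict_compl_singleton]
    refine Eq.trans ?_ h0.symm
    refine lintegral_congr fun x => ?_
    have hx : ‖(x : E)‖ ≠ 0 := norm_ne_zero_iff.2 x.2
    simp [smul_smul, hx, g]
  refine ⟨ν, ⟨?_⟩, hmap⟩
  have h1 : ((uniformSphere d).prod ν).map (fun z => (z.2 : ℝ) • (z.1 : E)) Set.univ = 1 := by
    rw [hmap]; exact measure_univ
  rw [Measure.map_apply hsm MeasurableSet.univ, Set.preimage_univ, ← Set.univ_prod_univ,
    Measure.prod_prod, measure_univ, one_mul] at h1
  exact h1

/-- A uniform point of the sphere, scaled by an independent random radius, has standard Gaussian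
one-dimensional marginals. -/
lemma exists_radial_measure {d : ℕ} (hd : 1 ≤ d) :
    ∃ ν : Measure (Set.Ioi (0 : ℝ)), IsProbabilityMeasure ν ∧
      ∀ u : EuclideanSpace ℝ (Fin d), ‖u‖ = 1 →
        ((uniformSphere d).prod ν).map
          (fun z => (z.2 : ℝ) * ⟪(z.1 : EuclideanSpace ℝ (Fin d)), u⟫) = gaussianReal 0 1 := by
  obtain ⟨ν, hν, hmap⟩ := map_smul_uniformSphere_prod hd
  refine ⟨ν, hν, fun u hu => ?_⟩
  rw [← map_inner_gaussianEuclidean hu, ← hmap, Measure.map_map (by fun_prop) (by fun_prop)]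
  congr 1
  ext z
  simp [real_inner_smul_left]

end SphereLaw

/-! ### Dimension-free subgaussian increments -/

section SubgaussianIncrements

/-- The first absolute moment of the standard Gaussian distribution. -/
noncomputable def gaussianMeanAbs : ℝ := ∫ t, |t| ∂(gaussianReal 0 1)

lemma integrable_abs_gaussianReal : Integrable (fun t : ℝ => |t|) (gaussianReal 0 1) :=
  ((memLp_id_gaussianReal 1).integrable (by simp)).abs

lemma gaussianMeanAbs_pos : 0 < gaussianMeanAbs := by
  refine (integral_pos_iff_support_of_nonneg (fun t => abs_nonneg t)
    integrable_abs_gaussianReal).2 ?_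
  have hsupp : Function.support (fun t : ℝ => |t|) = {0}ᶜ := by
    ext t; simp
  have hna := nullSingletonClass_gaussianReal (μ := 0) (v := 1) one_ne_zero
  rw [hsupp, prob_compl_eq_one_sub (measurableSet_singleton _), measure_singleton]
  simp

lemma integrable_sphere {d : ℕ} (hd : 1 ≤ d)
    {f : Metric.sphere (0 : EuclideanSpace ℝ (Fin d)) 1 → ℝ} (hf : Continuous f) :
    Integrable f (uniformSphere d) := by
  have := isProbabilityMeasure_uniformSphere hd
  exact hf.integrable_of_hasCompactSupport (HasCompactSupport.of_compactSpace f)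

/-- A sphere coordinate has a subgaussian moment generating function on the scale of the
inverse of the mean radius `ρ` of a Gaussian vector. -/
lemma exists_scale_mgf_inner_le {d : ℕ} (hd : 1 ≤ d) :
    ∃ ρ : ℝ, (∀ u : EuclideanSpace ℝ (Fin d), ‖u‖ = 1 →
        sphereMeanAbs d u * ρ = gaussianMeanAbs) ∧
      ∀ (v : EuclideanSpace ℝ (Fin d)) (s : ℝ),
        ∫ x, Real.exp (s * ρ * ⟪(x : EuclideanSpace ℝ (Fin d)), v⟫) ∂(uniformSphere d) ≤
          Real.exp (s ^ 2 * ‖v‖ ^ 2 / 2) := by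
  have := nontrivial_euclideanSpace hd
  have := isProbabilityMeasure_uniformSphere hd
  obtain ⟨ν, hν, hmap⟩ := exists_radial_measure hd
  have hmul (u : EuclideanSpace ℝ (Fin d)) (hu : ‖u‖ = 1) :
      sphereMeanAbs d u * ∫ r : Set.Ioi (0 : ℝ), (r : ℝ) ∂ν = gaussianMeanAbs := by
    rw [sphereMeanAbs, ← integral_prod_mul, gaussianMeanAbs, ← hmap u hu,
      integral_map (by fun_prop) (by fun_prop)]
    refine integral_congr_ae (Filter.Eventually.of_forall fun z => ?_)
    simp only
    rw [abs_mul, abs_of_pos (show (0 : ℝ) < (z.2 : ℝ) from z.2.2), mul_comm]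
  -- If the radius were not integrable, its integral would be 0 by convention, contradicting `hmul`,
  -- which holds without integrability.
  have hint : Integrable (fun r : Set.Ioi (0 : ℝ) => (r : ℝ)) ν := by
    by_contra h
    obtain ⟨u, hu⟩ := exists_norm_eq (EuclideanSpace ℝ (Fin d)) zero_le_one
    have h1 := hmul u hu
    rw [integral_undef h, mul_zero] at h1
    exact gaussianMeanAbs_pos.ne h1
  have hunit (u : EuclideanSpace ℝ (Fin d)) (hu : ‖u‖ = 1) (s : ℝ) :
      ∫ x, Real.exp (s * (∫ r : Set.Ioi (0 : ℝ), (r : ℝ) ∂ν) *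
        ⟪(x : EuclideanSpace ℝ (Fin d)), u⟫) ∂(uniformSphere d) ≤ Real.exp (s ^ 2 / 2) := by
    have hF : Measurable fun z : Metric.sphere (0 : EuclideanSpace ℝ (Fin d)) 1 × Set.Ioi (0 : ℝ) =>
        (z.2 : ℝ) * ⟪(z.1 : EuclideanSpace ℝ (Fin d)), u⟫ := by fun_prop
    have hgint : Integrable (fun z : Metric.sphere (0 : EuclideanSpace ℝ (Fin d)) 1 ×
        Set.Ioi (0 : ℝ) => Real.exp (s * ((z.2 : ℝ) * ⟪(z.1 : EuclideanSpace ℝ (Fin d)), u⟫)))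
        ((uniformSphere d).prod ν) := by
      have h1 := integrable_exp_mul_gaussianReal (μ := 0) (v := 1) s
      rw [← hmap u hu, integrable_map_measure (by fun_prop) hF.aemeasurable] at h1
      exact h1
    have hval : ∫ z : Metric.sphere (0 : EuclideanSpace ℝ (Fin d)) 1 × Set.Ioi (0 : ℝ),
        Real.exp (s * ((z.2 : ℝ) * ⟪(z.1 : EuclideanSpace ℝ (Fin d)), u⟫))
          ∂((uniformSphere d).prod ν) = Real.exp (s ^ 2 / 2) := by
      have h1 := mgf_gaussianReal (μ := 0) (v := 1) (hmap u hu) s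
      rw [mgf] at h1
      rw [h1]
      simp
    rw [← hval, integral_prod _ hgint]
    refine integral_mono_ae (integrable_sphere hd (by fun_prop)) hgint.integral_prod_left ?_
    filter_upwards [hgint.prod_right_ae] with x hx
    -- Jensen in the radius for fixed x: replacing the radius by its mean only lowers the
    -- exponential moment.
    have hj := convexOn_exp.map_integral_le (μ := ν) (s := Set.univ)
      (f := fun r : Set.Ioi (0 : ℝ) => s * ((r : ℝ) * ⟪(x : EuclideanSpace ℝ (Fin d)), u⟫))
      Real.continuous_exp.continuousOn isClosed_univ (by simp)
      ((hint.mul_const _).const_mul _) hx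
    refine le_trans (le_of_eq ?_) hj
    rw [integral_const_mul, integral_mul_const, mul_assoc]
  refine ⟨∫ r : Set.Ioi (0 : ℝ), (r : ℝ) ∂ν, hmul, fun v s => ?_⟩
  rcases eq_or_ne v 0 with rfl | hv
  · simp
  have hv' : ‖v‖ ≠ 0 := norm_ne_zero_iff.2 hv
  have h1 := hunit (‖v‖⁻¹ • v) (by rw [norm_smul, norm_inv, norm_norm, inv_mul_cancel₀ hv'])
    (s * ‖v‖)
  rw [mul_pow] at h1
  refine le_trans (le_of_eq ?_) h1
  refine integral_congr_ae (Filter.Eventually.of_forall fun x => ?_)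
  simp only [real_inner_smul_right]
  congr 1
  field_simp

lemma sphereMeanAbs_pos {d : ℕ} (hd : 1 ≤ d) {u : EuclideanSpace ℝ (Fin d)} (hu : ‖u‖ = 1) :
    0 < sphereMeanAbs d u := by
  obtain ⟨ρ, hρ, -⟩ := exists_scale_mgf_inner_le hd
  refine lt_of_le_of_ne (integral_nonneg fun x => abs_nonneg _) fun h => ?_
  have := hρ u hu
  rw [← h, zero_mul] at this
  exact gaussianMeanAbs_pos.ne this

lemma integral_abs_inner {d : ℕ} (hd : 1 ≤ d) {u : EuclideanSpace ℝ (Fin d)} (hu : ‖u‖ = 1)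
    (v : EuclideanSpace ℝ (Fin d)) :
    ∫ x, |⟪(x : EuclideanSpace ℝ (Fin d)), v⟫| ∂(uniformSphere d) = sphereMeanAbs d u * ‖v‖ := by
  rcases eq_or_ne v 0 with rfl | hv
  · simp
  have hv' : ‖v‖ ≠ 0 := norm_ne_zero_iff.2 hv
  obtain ⟨ρ, hρ, -⟩ := exists_scale_mgf_inner_le hd
  have hn : ‖‖v‖⁻¹ • v‖ = 1 := by rw [norm_smul, norm_inv, norm_norm, inv_mul_cancel₀ hv']
  have hρ0 : ρ ≠ 0 := by
    rintro rfl
    have := hρ u hu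
    rw [mul_zero] at this
    exact gaussianMeanAbs_pos.ne this
  have h1 : sphereMeanAbs d u = sphereMeanAbs d (‖v‖⁻¹ • v) :=
    mul_right_cancel₀ hρ0 ((hρ u hu).trans (hρ _ hn).symm)
  rw [h1, sphereMeanAbs, ← integral_mul_const]
  refine integral_congr_ae (Filter.Eventually.of_forall fun x => ?_)
  simp only [real_inner_smul_right, abs_mul, abs_inv, abs_norm]
  field_simp

/-- Symmetrization of a centered exponential moment. -/
lemma integral_exp_sub_integral_le {X : Type*} [MeasurableSpace X] {μ : Measure X}
    [IsProbabilityMeasure μ] {g : X → ℝ} (hg : Integrable g μ)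
    (hp : MemLp (fun x => Real.exp (g x)) 2 μ) (hn : MemLp (fun x => Real.exp (-g x)) 2 μ) :
    ∫ x, Real.exp (g x - ∫ y, g y ∂μ) ∂μ ≤
      (∫ x, Real.exp (2 * g x) ∂μ + ∫ x, Real.exp (-(2 * g x)) ∂μ) / 2 := by
  have hsq {f : X → ℝ} (hf : MemLp (fun x => Real.exp (f x)) 2 μ) :
      (∫ x, Real.exp (f x) ∂μ) ^ 2 ≤ ∫ x, Real.exp (2 * f x) ∂μ := by
    have h1 := variance_nonneg (fun x => Real.exp (f x)) μ
    rw [variance_eq_sub hf] at h1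
    have h2 : ∀ x, ((fun x => Real.exp (f x)) ^ 2) x = Real.exp (2 * f x) := fun x => by
      rw [Pi.pow_apply, ← Real.exp_nat_mul]; simp
    simp_rw [h2] at h1
    linarith
  -- Jensen gives exp(-E g) ≤ E exp(-g), as if an independent copy of g were subtracted.
  have hj := convexOn_exp.map_integral_le (μ := μ) (s := Set.univ) (f := fun x => -g x)
    Real.continuous_exp.continuousOn isClosed_univ (by simp) hg.neg (hn.integrable (by norm_num))
  rw [integral_neg] at hj
  have h2 := hsq hp
  have h3 := hsq hn
  simp_rw [mul_neg] at h3
  have h0 : 0 ≤ ∫ x, Real.exp (g x) ∂μ := integral_nonneg fun x => (Real.exp_pos _).le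
  calc ∫ x, Real.exp (g x - ∫ y, g y ∂μ) ∂μ
      = (∫ x, Real.exp (g x) ∂μ) * Real.exp (-∫ y, g y ∂μ) := by
        rw [← integral_mul_const]
        simp_rw [← Real.exp_add, sub_eq_add_neg]
    _ ≤ (∫ x, Real.exp (g x) ∂μ) * ∫ x, Real.exp (-g x) ∂μ := mul_le_mul_of_nonneg_left hj h0
    _ ≤ _ := by nlinarith [sq_nonneg ((∫ x, Real.exp (g x) ∂μ) - ∫ x, Real.exp (-g x) ∂μ)]

lemma hasSubgaussianMGF_abs_inner_sub {d : ℕ} (hd : 1 ≤ d) {u : EuclideanSpace ℝ (Fin d)}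
    (hu : ‖u‖ = 1) {v w : EuclideanSpace ℝ (Fin d)} {r : ℝ} (hr : ‖v - w‖ ≤ r) :
    HasSubgaussianMGF (fun x : Metric.sphere (0 : EuclideanSpace ℝ (Fin d)) 1 =>
        (|⟪(x : EuclideanSpace ℝ (Fin d)), v⟫| / sphereMeanAbs d u - ‖v‖) -
          (|⟪(x : EuclideanSpace ℝ (Fin d)), w⟫| / sphereMeanAbs d u - ‖w‖))
      (Real.toNNReal (4 / gaussianMeanAbs ^ 2 * r ^ 2)) (uniformSphere d) where
  integrable_exp_mul t := integrable_sphere hd (by fun_prop)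
  mgf_le t := by
    have := isProbabilityMeasure_uniformSphere hd
    obtain ⟨ρ, hρ, hexp⟩ := exists_scale_mgf_inner_le hd
    have ha := gaussianMeanAbs_pos
    have hm := sphereMeanAbs_pos hd hu
    have hρu := hρ u hu
    set m := sphereMeanAbs d u with hmdef
    set a := gaussianMeanAbs
    let g : Metric.sphere (0 : EuclideanSpace ℝ (Fin d)) 1 → ℝ := fun x =>
      t / m * (|⟪(x : EuclideanSpace ℝ (Fin d)), v⟫| - |⟪(x : EuclideanSpace ℝ (Fin d)), w⟫|)
    have hgc : Continuous g := by fun_prop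
    have hgi : ∫ x, g x ∂(uniformSphere d) = t * (‖v‖ - ‖w‖) := by
      simp only [g]
      rw [integral_const_mul, integral_sub (integrable_sphere hd (by fun_prop))
        (integrable_sphere hd (by fun_prop)), integral_abs_inner hd hu, integral_abs_inner hd hu,
        ← hmdef]
      field_simp
    have hLp {f : Metric.sphere (0 : EuclideanSpace ℝ (Fin d)) 1 → ℝ} (hf : Continuous f) :
        MemLp f 2 (uniformSphere d) :=
      hf.memLp_of_hasCompactSupport (HasCompactSupport.of_compactSpace f)
    have hsymm := integral_exp_sub_integral_le (μ := uniformSphere d) (g := g)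
      (integrable_sphere hd hgc) (hLp (by fun_prop)) (hLp (by fun_prop))
    rw [hgi] at hsymm
    have hside (s : ℝ) (hs : s ^ 2 = (2 * t / a) ^ 2) :
        ∫ x, Real.exp (s * ρ * ⟪(x : EuclideanSpace ℝ (Fin d)), v - w⟫) ∂(uniformSphere d) ≤
          Real.exp (4 / a ^ 2 * r ^ 2 * t ^ 2 / 2) := by
      refine (hexp (v - w) s).trans (Real.exp_le_exp.2 ?_)
      have h1 : ‖v - w‖ ^ 2 ≤ r ^ 2 := pow_le_pow_left₀ (norm_nonneg _) hr 2
      rw [hs]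
      have h2 : (2 * t / a) ^ 2 * ‖v - w‖ ^ 2 ≤ (2 * t / a) ^ 2 * r ^ 2 :=
        mul_le_mul_of_nonneg_left h1 (sq_nonneg _)
      have h3 : (2 * t / a) ^ 2 * r ^ 2 = 4 / a ^ 2 * r ^ 2 * t ^ 2 := by
        field_simp; ring
      linarith
    -- Contraction: cosh is even and increasing in |·|, and ||⟪x, v⟫| - |⟪x, w⟫|| ≤ |⟪x, v - w⟫|.
    -- The factor 2 / a comes from a = m ρ.
    have hcosh : ∫ x, Real.exp (2 * g x) ∂(uniformSphere d) +
        ∫ x, Real.exp (-(2 * g x)) ∂(uniformSphere d) ≤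
        ∫ x, Real.exp (2 * t / a * ρ * ⟪(x : EuclideanSpace ℝ (Fin d)), v - w⟫)
            ∂(uniformSphere d) +
          ∫ x, Real.exp (-(2 * t / a) * ρ * ⟪(x : EuclideanSpace ℝ (Fin d)), v - w⟫)
            ∂(uniformSphere d) := by
      rw [← integral_add (integrable_sphere hd (by fun_prop)) (integrable_sphere hd (by fun_prop)),
        ← integral_add (integrable_sphere hd (by fun_prop)) (integrable_sphere hd (by fun_prop))]
      refine integral_mono (integrable_sphere hd (by fun_prop)) (integrable_sphere hd (by fun_prop))
        fun x => ?_
      have habs : |2 * g x| ≤ |2 * t / a * ρ * ⟪(x : EuclideanSpace ℝ (Fin d)), v - w⟫| := by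
        have hk : 2 * t / a * ρ = 2 * (t / m) := by
          rw [← hρu]
          have : ρ ≠ 0 := by
            rintro rfl
            rw [mul_zero] at hρu
            exact ha.ne hρu
          field_simp
        rw [hk]
        simp only [g]
        rw [← mul_assoc, abs_mul (2 * (t / m)), abs_mul (2 * (t / m)), inner_sub_right]
        exact mul_le_mul_of_nonneg_left (abs_abs_sub_abs_le_abs_sub _ _) (abs_nonneg _)
      have := Real.cosh_le_cosh.2 habs
      rw [Real.cosh_eq, Real.cosh_eq] at this
      simp only [neg_mul]
      linarith
    have h1 := hside (2 * t / a) rfl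
    have h2 := hside (-(2 * t / a)) (neg_sq _)
    rw [mgf, Real.coe_toNNReal _ (by positivity)]
    calc _ = ∫ x, Real.exp (g x - t * (‖v‖ - ‖w‖)) ∂(uniformSphere d) := by
          refine integral_congr_ae (Filter.Eventually.of_forall fun x => ?_)
          simp only [g]
          congr 1
          ring
      _ ≤ _ := by linarith

end SubgaussianIncrements

/-! ### Nets of the unit ball and chaining -/

section Chaining

-- Volume packing: the balls of radius ε/2 around the points are disjoint and lie in the ball of
-- radius 1 + ε/2.
open scoped Function in
lemma card_le_of_separated_unitBall {E : Type*} [NormedAddCommGroup E] [NormedSpace ℝ E]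
    [FiniteDimensional ℝ E] {ε : ℝ} (hε : 0 < ε) (s : Finset E) (hs : ∀ x ∈ s, ‖x‖ ≤ 1)
    (h : ∀ x ∈ s, ∀ y ∈ s, x ≠ y → ε ≤ ‖x - y‖) :
    (s.card : ℝ) ≤ (2 / ε + 1) ^ Module.finrank ℝ E := by
  borelize E
  let μ : Measure E := Measure.addHaar
  have hδ : 0 < ε / 2 := half_pos hε
  have hR : 0 < 1 + ε / 2 := by linarith
  have hdisj : Set.Pairwise (s : Set E) (Disjoint on fun c => Metric.ball (c : E) (ε / 2)) := by
    intro c hc c' hc' hne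
    refine Metric.ball_disjoint_ball ?_
    rw [dist_eq_norm]
    linarith [h c hc c' hc' hne]
  have hsub : ⋃ c ∈ s, Metric.ball (c : E) (ε / 2) ⊆ Metric.ball (0 : E) (1 + ε / 2) := by
    refine Set.iUnion₂_subset fun x hx => Metric.ball_subset_ball' ?_
    rw [dist_zero_right]
    linarith [hs x hx]
  have hvol : (s.card : ENNReal) * ENNReal.ofReal ((ε / 2) ^ Module.finrank ℝ E) *
      μ (Metric.ball 0 1) ≤
      ENNReal.ofReal ((1 + ε / 2) ^ Module.finrank ℝ E) * μ (Metric.ball 0 1) :=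
    calc _ = μ (⋃ c ∈ s, Metric.ball (c : E) (ε / 2)) := by
          rw [measure_biUnion_finset hdisj fun c _ => measurableSet_ball]
          simp only [μ.addHaar_ball_of_pos _ hδ, Finset.sum_const, nsmul_eq_mul, mul_assoc]
      _ ≤ μ (Metric.ball (0 : E) (1 + ε / 2)) := measure_mono hsub
      _ = _ := μ.addHaar_ball_of_pos _ hR
  have hcard := (ENNReal.mul_le_mul_iff_left (Metric.measure_ball_pos _ _ zero_lt_one).ne'
    measure_ball_lt_top.ne).1 hvol
  have hreal : (s.card : ℝ) * (ε / 2) ^ Module.finrank ℝ E ≤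
      (1 + ε / 2) ^ Module.finrank ℝ E := by
    have := ENNReal.toReal_le_of_le_ofReal (pow_nonneg hR.le _) hcard
    rwa [ENNReal.toReal_mul, ENNReal.toReal_natCast, ENNReal.toReal_ofReal (by positivity)] at this
  have he : 2 / ε + 1 = (1 + ε / 2) / (ε / 2) := by field_simp
  rw [he, div_pow]
  exact (le_div_iff₀ (by positivity)).2 hreal

/-- A separated set of maximal cardinality is a net, since an uncovered point could be added to it.
-/
lemma exists_finset_net_unitBall (E : Type*) [NormedAddCommGroup E] [NormedSpace ℝ E]
    [FiniteDimensional ℝ E] {ε : ℝ} (hε : 0 < ε) :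
    ∃ s : Finset E, (s.card : ℝ) ≤ (2 / ε + 1) ^ Module.finrank ℝ E ∧
      ∀ x : E, ‖x‖ ≤ 1 → ∃ y ∈ s, ‖x - y‖ ≤ ε := by
  classical
  let good : Finset E → Prop := fun s =>
    (∀ x ∈ s, ‖x‖ ≤ 1) ∧ ∀ x ∈ s, ∀ y ∈ s, x ≠ y → ε ≤ ‖x - y‖
  let C : Set ℕ := {n | ∃ s : Finset E, good s ∧ s.card = n}
  have hne : C.Nonempty := ⟨0, ∅, ⟨by simp, by simp⟩, by simp⟩
  have hbdd : BddAbove C := by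
    refine ⟨⌊(2 / ε + 1) ^ Module.finrank ℝ E⌋₊, ?_⟩
    rintro n ⟨s, hs, rfl⟩
    exact Nat.le_floor (card_le_of_separated_unitBall hε s hs.1 hs.2)
  obtain ⟨s, hs, hcard⟩ := Nat.sSup_mem hne hbdd
  refine ⟨s, card_le_of_separated_unitBall hε s hs.1 hs.2, fun x hx => ?_⟩
  by_contra! hfar
  have hxs : x ∉ s := fun hmem => by
    have := hfar x hmem
    rw [sub_self, norm_zero] at this
    linarith
  have hgood : good (insert x s) := by
    refine ⟨fun y hy => ?_, fun y hy z hz hyz => ?_⟩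
    · rcases Finset.mem_insert.1 hy with rfl | hy
      · exact hx
      · exact hs.1 y hy
    · rcases Finset.mem_insert.1 hy with hyx | hys <;>
        rcases Finset.mem_insert.1 hz with hzx | hzs
      · exact absurd (hyx.trans hzx.symm) hyz
      · rw [hyx]; exact (hfar z hzs).le
      · rw [hzx, norm_sub_rev]; exact (hfar y hys).le
      · exact hs.2 y hys z hzs hyz
  have := le_csSup hbdd ⟨insert x s, hgood, rfl⟩
  rw [Finset.card_insert_of_notMem hxs] at this
  omega

/-- Level 0 is {0}, so that chains start where the process vanishes. The exponent k + 2 comes from 2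
· 2^k + 1 ≤ 2^(k+2) ≤ e^(k+2). -/
lemma exists_dyadic_nets_unitBall (E : Type*) [NormedAddCommGroup E] [NormedSpace ℝ E]
    [FiniteDimensional ℝ E] :
    ∃ S : ℕ → Finset E, S 0 = {0} ∧
      (∀ k, ((S k).card : ℝ) ≤ Real.exp ((k + 2) * Module.finrank ℝ E)) ∧
      ∀ k, ∀ x : E, ‖x‖ ≤ 1 → ∃ y ∈ S k, ‖x - y‖ ≤ (1 / 2) ^ k := by
  choose T hT hT' using fun k : ℕ =>
    exists_finset_net_unitBall E (ε := (1 / 2) ^ k) (by positivity)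
  refine ⟨fun k => if k = 0 then {0} else T k, by simp, fun k => ?_, fun k x hx => ?_⟩
  · rcases Nat.eq_zero_or_pos k with rfl | hk
    · simp only [if_true, Finset.card_singleton, Nat.cast_one]
      exact Real.one_le_exp (by positivity)
    · simp only [hk.ne', if_false]
      refine (hT k).trans ?_
      rw [mul_comm, Real.exp_nat_mul]
      refine pow_le_pow_left₀ (by positivity) ?_ _
      have h2 : (2 : ℝ) ≤ Real.exp 1 := by
        have := Real.add_one_le_exp 1
        linarith
      have h3 : Real.exp ((k : ℝ) + 2) = Real.exp 1 ^ (k + 2) := by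
        rw [← Real.exp_nat_mul]; push_cast; ring_nf
      rw [h3]
      refine le_trans ?_ (pow_le_pow_left₀ (by norm_num) h2 (k + 2))
      have h4 : 2 / (1 / 2 : ℝ) ^ k = 2 * 2 ^ k := by
        rw [one_div, inv_pow, div_inv_eq_mul]
      have h5 : (1 : ℝ) ≤ 2 ^ k := one_le_pow₀ (by norm_num)
      rw [h4, pow_add]
      linarith
  · rcases Nat.eq_zero_or_pos k with rfl | hk
    · exact ⟨0, by simp, by simpa using hx⟩
    · obtain ⟨y, hy, hxy⟩ := hT' k x hx
      exact ⟨y, by simpa [hk.ne'] using hy, hxy⟩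

/-- Supremum bound for a continuous function that is small along all links of a dyadic chain. -/
lemma abs_le_of_chain {E : Type*} [NormedAddCommGroup E] {f : E → ℝ} (hf : Continuous f)
    (h0 : f 0 = 0) {S : ℕ → Finset E} (hS0 : S 0 = {0})
    (hS : ∀ k, ∀ x : E, ‖x‖ ≤ 1 → ∃ y ∈ S k, ‖x - y‖ ≤ (1 / 2) ^ k) {u : ℝ} (hu : 0 < u)
    (hlink : ∀ k, ∀ w ∈ S k, ∀ w' ∈ S (k + 1), ‖w' - w‖ ≤ 2 * (1 / 2) ^ k →
      |f w' - f w| < u / 8 * (3 / 4) ^ k) {v : E} (hv : ‖v‖ ≤ 1) : |f v| ≤ u := by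
  choose π hπS hπ using fun k => hS k v hv
  -- The right-hand side is the partial geometric sum of the link bounds u/8 · (3/4)^j.
  have hstep (n : ℕ) : |f (π n)| ≤ u / 2 * (1 - (3 / 4) ^ n) := by
    induction n with
    | zero =>
      have : π 0 = 0 := by simpa [hS0] using hπS 0
      simp [this, h0]
    | succ n ih =>
      have hclose : ‖π (n + 1) - π n‖ ≤ 2 * (1 / 2) ^ n := by
        have h1 : π (n + 1) - π n = (v - π n) - (v - π (n + 1)) := by abel
        have h2 := hπ (n + 1)
        rw [pow_succ] at h2
        have h3 : (0 : ℝ) ≤ (1 / 2) ^ n := by positivity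
        rw [h1]
        exact (norm_sub_le _ _).trans (by linarith [hπ n])
      have h1 := hlink n _ (hπS n) _ (hπS (n + 1)) hclose
      have h2 : |f (π (n + 1))| ≤ |f (π (n + 1)) - f (π n)| + |f (π n)| := by
        simpa using abs_add_le (f (π (n + 1)) - f (π n)) (f (π n))
      rw [pow_succ]
      nlinarith
  have hlim : Filter.Tendsto π Filter.atTop (nhds v) := by
    rw [tendsto_iff_norm_sub_tendsto_zero]
    refine squeeze_zero (fun _ => norm_nonneg _) (fun n => ?_)
      (tendsto_pow_atTop_nhds_zero_of_lt_one (r := (1 / 2 : ℝ)) (by norm_num) (by norm_num))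
    rw [norm_sub_rev]
    exact hπ n
  refine le_of_tendsto ((hf.tendsto v).comp hlim).abs (Filter.Eventually.of_forall fun n => ?_)
  refine (hstep n).trans ?_
  have : (0 : ℝ) ≤ (3 / 4) ^ n := by positivity
  nlinarith

/-- Chaining bound without logarithmic loss for a process with subgaussian increments. -/
theorem measure_exists_lt_abs_le_of_subgaussian_increments {Ω : Type*} [MeasurableSpace Ω]
    {μ : Measure Ω} [IsProbabilityMeasure μ] {E : Type*} [NormedAddCommGroup E] [NormedSpace ℝ E]
    [FiniteDimensional ℝ E] (hE : 1 ≤ Module.finrank ℝ E) {Y : E → Ω → ℝ}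
    (h0 : ∀ ω, Y 0 ω = 0) (hcont : ∀ ω, Continuous fun v => Y v ω) {V : ℝ} (hV : 0 < V)
    (htail : ∀ (v w : E) (r t : ℝ), 0 < r → ‖v - w‖ ≤ r → 0 ≤ t →
      μ.real {ω | t ≤ |Y v ω - Y w ω|} ≤ 2 * Real.exp (-(t ^ 2 / (2 * V * r ^ 2))))
    {u : ℝ} (hu : 0 < u) :
    μ.real {ω | ∃ v, ‖v‖ ≤ 1 ∧ u < |Y v ω|} ≤
      2 * Real.exp (6 * Module.finrank ℝ E - u ^ 2 / (512 * V)) := by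
  obtain ⟨S, hS0, hcard, hS⟩ := exists_dyadic_nets_unitBall E
  set D : ℝ := (Module.finrank ℝ E : ℝ) with hD
  have hD1 : (1 : ℝ) ≤ D := by rw [hD]; exact_mod_cast hE
  set q : ℝ := Real.exp (5 * D - u ^ 2 / (512 * V)) with hq
  have hq0 : 0 < q := Real.exp_pos _
  have heq : Real.exp (6 * D - u ^ 2 / (512 * V)) = Real.exp D * q := by
    rw [hq, ← Real.exp_add]; ring_nf
  have hexpD : 2 ≤ Real.exp D := by linarith [Real.add_one_le_exp D]
  rw [heq]
  -- For q > 1/2 the claimed bound exceeds 1; otherwise the geometric series over levels is at most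
  -- 4q.
  rcases lt_or_ge (1 / 2) q with hqbig | hqsmall
  · refine measureReal_le_one.trans ?_
    nlinarith
  let bad : ℕ → E × E → Set Ω := fun k z =>
    {ω | ‖z.2 - z.1‖ ≤ 2 * (1 / 2) ^ k ∧ u / 8 * (3 / 4) ^ k ≤ |Y z.2 ω - Y z.1 ω|}
  have hsub : {ω | ∃ v, ‖v‖ ≤ 1 ∧ u < |Y v ω|} ⊆ ⋃ k, ⋃ z ∈ S k ×ˢ S (k + 1), bad k z := by
    rintro ω ⟨v, hv, huv⟩
    by_contra hω
    refine huv.not_ge (abs_le_of_chain (hcont ω) (h0 ω) hS0 hS hu (fun k w hw w' hw' hc => ?_) hv)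
    by_contra! hbig
    exact hω (Set.mem_iUnion.2 ⟨k, Set.mem_iUnion₂.2
      ⟨(w, w'), Finset.mem_product.2 ⟨hw, hw'⟩, hc, hbig⟩⟩)
  have hbad (k : ℕ) (z : E × E) :
      μ.real (bad k z) ≤ 2 * Real.exp (-(u ^ 2 / (512 * V) * (k + 1))) := by
    by_cases hc : ‖z.2 - z.1‖ ≤ 2 * (1 / 2) ^ k
    · refine (measureReal_mono fun ω hω => hω.2).trans
        ((htail z.2 z.1 (2 * (1 / 2) ^ k) (u / 8 * (3 / 4) ^ k) (by positivity) hc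
          (by positivity)).trans ?_)
      -- Link lengths halve while thresholds shrink only by 3/4, so the exponent grows like (9/4)^k
      -- and beats the entropy, linear in k.
      have h1 : (u / 8 * (3 / 4) ^ k) ^ 2 / (2 * V * (2 * (1 / 2) ^ k) ^ 2) =
          u ^ 2 / (512 * V) * (9 / 4) ^ k := by
        have h2 : ((3 / 4 : ℝ) ^ k) ^ 2 = (9 / 4) ^ k * ((1 / 2) ^ k) ^ 2 := by
          rw [← pow_mul, ← pow_mul, mul_comm k 2, pow_mul, pow_mul, ← mul_pow]
          norm_num
        have h3 : ((1 / 2 : ℝ) ^ k) ≠ 0 := by positivity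
        rw [mul_pow, mul_pow, h2]
        generalize (1 / 2 : ℝ) ^ k = y at h3
        generalize (9 / 4 : ℝ) ^ k = x
        field_simp
        ring
      have h4 : (k : ℝ) + 1 ≤ (9 / 4) ^ k := by
        have := one_add_mul_le_pow (a := (5 / 4 : ℝ)) (by norm_num) k
        have hk : (0 : ℝ) ≤ k := k.cast_nonneg
        norm_num at this
        linarith
      rw [h1]
      have h5 : u ^ 2 / (512 * V) * (k + 1) ≤ u ^ 2 / (512 * V) * (9 / 4) ^ k :=
        mul_le_mul_of_nonneg_left h4 (by positivity)
      gcongr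
    · have : bad k z = ∅ := Set.eq_empty_of_forall_notMem fun ω hω => hc hω.1
      rw [this]
      simp only [measureReal_empty]
      positivity
  have hlevel (k : ℕ) : μ.real (⋃ z ∈ S k ×ˢ S (k + 1), bad k z) ≤ 2 * q ^ (k + 1) := by
    refine (measureReal_biUnion_finset_le _ _).trans ?_
    refine (Finset.sum_le_card_nsmul _ _ _ fun z _ => hbad k z).trans ?_
    rw [nsmul_eq_mul, Finset.card_product, Nat.cast_mul]
    have h1 := hcard k
    have h2 := hcard (k + 1)
    -- The exponents add up to (k + 2) + (k + 3) ≤ 5 (k + 1).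
    have h3 : ((S k).card : ℝ) * (S (k + 1)).card ≤ Real.exp (5 * D * (k + 1)) := by
      refine (mul_le_mul h1 h2 (Nat.cast_nonneg _) (Real.exp_pos _).le).trans ?_
      rw [← Real.exp_add]
      refine Real.exp_le_exp.2 ?_
      push_cast
      have hk : (0 : ℝ) ≤ k := k.cast_nonneg
      nlinarith
    have h4 : q ^ (k + 1) =
        Real.exp (5 * D * (k + 1)) * Real.exp (-(u ^ 2 / (512 * V) * (k + 1))) := by
      rw [hq, ← Real.exp_nat_mul, ← Real.exp_add]
      push_cast
      ring_nf
    rw [h4]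
    have := mul_le_mul_of_nonneg_right h3
      (Real.exp_pos (-(u ^ 2 / (512 * V) * (k + 1)))).le
    linarith
  have hgeom : HasSum (fun k : ℕ => 2 * q ^ (k + 1)) (2 * q * (1 - q)⁻¹) := by
    have := (hasSum_geometric_of_lt_one hq0.le (by linarith : q < 1)).mul_left (2 * q)
    simpa only [pow_succ', mul_assoc] using this
  have hmeas : μ (⋃ k, ⋃ z ∈ S k ×ˢ S (k + 1), bad k z) ≤ ENNReal.ofReal (2 * q * (1 - q)⁻¹) := by
    rw [← hgeom.tsum_eq, ENNReal.ofReal_tsum_of_nonneg (fun k => by positivity) hgeom.summable]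
    refine (measure_iUnion_le _).trans (ENNReal.tsum_le_tsum fun k => ?_)
    rw [← ofReal_measureReal (measure_ne_top _ _)]
    exact ENNReal.ofReal_le_ofReal (hlevel k)
  have hinv : (1 - q)⁻¹ ≤ 2 := by
    rw [inv_le_comm₀ (by linarith) (by norm_num)]
    linarith
  calc μ.real {ω | ∃ v, ‖v‖ ≤ 1 ∧ u < |Y v ω|}
      ≤ μ.real (⋃ k, ⋃ z ∈ S k ×ˢ S (k + 1), bad k z) := measureReal_mono hsub
    _ ≤ 2 * q * (1 - q)⁻¹ := ENNReal.toReal_le_of_le_ofReal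
        (mul_nonneg (by positivity) (inv_nonneg.2 (by linarith))) hmeas
    _ ≤ 2 * q * 2 := mul_le_mul_of_nonneg_left hinv (by positivity)
    _ ≤ 2 * (Real.exp D * q) := by nlinarith

end Chaining

/-! ### Deviation bound, general position and the final constant -/

section RandomPolyhedron

lemma measure_sum_abs_inner_deviation_le {d N : ℕ} (hd : 1 ≤ d) (hN : 1 ≤ N) {Ω : Type*}
    [MeasurableSpace Ω] {μ : Measure Ω} [IsProbabilityMeasure μ]
    {p : Fin N → Ω → Metric.sphere (0 : EuclideanSpace ℝ (Fin d)) 1}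
    (hp : ∀ i, HasLaw (p i) (uniformSphere d) μ) (hind : iIndepFun p μ)
    {u : EuclideanSpace ℝ (Fin d)} (hu : ‖u‖ = 1) {η : ℝ} (hη : 0 < η) :
    μ.real {ω | ∃ v : EuclideanSpace ℝ (Fin d), ‖v‖ ≤ 1 ∧ N * η <
        |∑ i, (|⟪(p i ω : EuclideanSpace ℝ (Fin d)), v⟫| / sphereMeanAbs d u - ‖v‖)|} ≤
      2 * Real.exp (6 * d - gaussianMeanAbs ^ 2 / 2048 * (N * η ^ 2)) := by
  have ha := gaussianMeanAbs_pos
  have hN' : (0 : ℝ) < N := by exact_mod_cast hN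
  -- Variance proxies add over the N independent points; with u = N η the chaining exponent u² /
  -- (512 V) becomes a² N η² / 2048, a = `gaussianMeanAbs`.
  have hV : (0 : ℝ) < N * (4 / gaussianMeanAbs ^ 2) := by positivity
  have htail (v w : EuclideanSpace ℝ (Fin d)) (r t : ℝ) (hr : 0 < r) (hvw : ‖v - w‖ ≤ r)
      (ht : 0 ≤ t) :
      μ.real {ω | t ≤ |∑ i, (|⟪(p i ω : EuclideanSpace ℝ (Fin d)), v⟫| / sphereMeanAbs d u - ‖v‖) -
        ∑ i, (|⟪(p i ω : EuclideanSpace ℝ (Fin d)), w⟫| / sphereMeanAbs d u - ‖w‖)|} ≤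
      2 * Real.exp (-(t ^ 2 / (2 * (N * (4 / gaussianMeanAbs ^ 2)) * r ^ 2))) := by
    let D : Metric.sphere (0 : EuclideanSpace ℝ (Fin d)) 1 → ℝ := fun x =>
      (|⟪(x : EuclideanSpace ℝ (Fin d)), v⟫| / sphereMeanAbs d u - ‖v‖) -
        (|⟪(x : EuclideanSpace ℝ (Fin d)), w⟫| / sphereMeanAbs d u - ‖w‖)
    have hD : Measurable D := by
      have : Continuous D := by fun_prop
      exact this.measurable
    have hsum := HasSubgaussianMGF.sum_of_iIndepFun (hind.comp (fun _ => D) fun _ => hD)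
      (s := Finset.univ) (c := fun _ => Real.toNNReal (4 / gaussianMeanAbs ^ 2 * r ^ 2))
      fun i _ => by
        refine HasSubgaussianMGF.of_map (hp i).aemeasurable ?_
        rw [(hp i).map_eq]
        exact hasSubgaussianMGF_abs_inner_sub hd hu hvw
    have h1 := hsum.measure_ge_le ht
    have h2 := hsum.neg.measure_ge_le ht
    have hc : -t ^ 2 / (2 * ((∑ _i : Fin N,
        Real.toNNReal (4 / gaussianMeanAbs ^ 2 * r ^ 2) : NNReal) : ℝ)) =
        -(t ^ 2 / (2 * (N * (4 / gaussianMeanAbs ^ 2)) * r ^ 2)) := by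
      rw [Finset.sum_const, Finset.card_univ, Fintype.card_fin, nsmul_eq_mul, NNReal.coe_mul,
        NNReal.coe_natCast, Real.coe_toNNReal _ (by positivity), neg_div]
      congr 2
      ring
    rw [hc] at h1 h2
    rw [two_mul]
    refine le_trans (le_trans (measureReal_mono ?_) (measureReal_union_le _ _)) (add_le_add h1 h2)
    intro ω hω
    rw [Set.mem_ofPred_eq, ← Finset.sum_sub_distrib] at hω
    exact le_abs.1 hω
  have hrank : Module.finrank ℝ (EuclideanSpace ℝ (Fin d)) = d := finrank_euclideanSpace_fin
  have h := measure_exists_lt_abs_le_of_subgaussian_increments (μ := μ) (hd.trans_eq hrank.symm)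
    (Y := fun v ω => ∑ i, (|⟪(p i ω : EuclideanSpace ℝ (Fin d)), v⟫| / sphereMeanAbs d u - ‖v‖))
    (fun ω => by simp) (fun ω => by fun_prop) hV htail (u := N * η) (by positivity)
  rw [hrank] at h
  refine h.trans (le_of_eq ?_)
  congr 3
  field_simp
  norm_num

lemma ae_forall_ne_and_ne_neg {d N : ℕ} (hd : 2 ≤ d) {Ω : Type*}
    [MeasurableSpace Ω] {μ : Measure Ω} [IsProbabilityMeasure μ]
    {p : Fin N → Ω → Metric.sphere (0 : EuclideanSpace ℝ (Fin d)) 1}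
    (hp : ∀ i, HasLaw (p i) (uniformSphere d) μ) (hind : iIndepFun p μ) :
    ∀ᵐ ω ∂μ, ∀ i j, i ≠ j → p i ω ≠ p j ω ∧ p i ω ≠ -p j ω := by
  have := isProbabilityMeasure_uniformSphere (show 1 ≤ d by omega)
  -- Used for the identity and the antipodal map. As T is an involution, each fibre of {x = T y} is
  -- a single point, hence null.
  have hne {T : Metric.sphere (0 : EuclideanSpace ℝ (Fin d)) 1 → Metric.sphere 0 1}
      (hT : Continuous T) (hT2 : ∀ x, T (T x) = x) {i j : Fin N} (hij : i ≠ j) :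
      ∀ᵐ ω ∂μ, p i ω ≠ T (p j ω) := by
    have hlaw := (indepFun_iff_hasLaw_prodMk_prod (hp i) (hp j)).1 (hind.indepFun hij)
    have hms : MeasurableSet {z : Metric.sphere (0 : EuclideanSpace ℝ (Fin d)) 1 ×
        Metric.sphere (0 : EuclideanSpace ℝ (Fin d)) 1 | z.1 = T z.2} :=
      measurableSet_eq_fun measurable_fst (hT.measurable.comp measurable_snd)
    have h0 : (uniformSphere d).prod (uniformSphere d) {z | z.1 = T z.2} = 0 := by
      rw [Measure.measure_prod_null hms]
      refine Filter.Eventually.of_forall fun x => ?_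
      refine measure_mono_null (fun y hy => ?_) (uniformSphere_singleton hd (T x))
      have hy' : x = T y := hy
      rw [Set.mem_singleton_iff, hy', hT2]
    have h1 := hlaw.measure_eq hms
    rw [h0] at h1
    rw [ae_iff]
    simpa using h1
  rw [ae_all_iff]; intro i
  rw [ae_all_iff]; intro j
  by_cases hij : i = j
  · exact Filter.Eventually.of_forall fun ω h => absurd hij h
  · filter_upwards [hne continuous_id (fun _ => rfl) hij,
      hne continuous_neg (fun x => neg_neg x) hij] with ω h1 h2 _
    exact ⟨h1, h2⟩

/-- A tail bound `2 exp (6 d - b N η²)` can be rewritten with one common constant in front of the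
entropy term and the deviation term, at the price of a factor `log (1 / δ)`. -/
lemma exists_common_constant {b : ℝ} (hb : 0 < b) :
    ∃ c : ℝ, 0 < c ∧ ∀ (d : ℕ) (B η P : ℝ), 2 ≤ d → 0 ≤ B → 0 < η → P ≤ 1 →
      P ≤ 2 * Real.exp (6 * d - b * B) →
      P ≤ 2 * Real.exp (c * (d * Real.log (1 / min η (1 / Real.sqrt d)) - B)) := by
  set D : ℝ := Real.exp (12 / b) with hD
  have hD0 : 0 < D := Real.exp_pos _
  refine ⟨min (b / 2) (b / (24 * D)), lt_min (by positivity) (by positivity), ?_⟩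
  intro d B η P hd hB hη hP1 hP
  set c := min (b / 2) (b / (24 * D)) with hc
  have hc0 : 0 < c := lt_min (by positivity) (by positivity)
  have hcb : c ≤ b / 2 := min_le_left _ _
  have hcD : c ≤ b / (24 * D) := min_le_right _ _
  have hd' : (2 : ℝ) ≤ d := by exact_mod_cast hd
  have hsqrt : 0 < Real.sqrt d := Real.sqrt_pos.2 (by linarith)
  set L := Real.log (1 / min η (1 / Real.sqrt d)) with hL
  have hLd : Real.log d / 2 ≤ L := by
    rw [← Real.log_sqrt (by linarith)]
    refine Real.log_le_log hsqrt ?_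
    rw [le_div_iff₀ (lt_min hη (by positivity))]
    calc Real.sqrt d * min η (1 / Real.sqrt d) ≤ Real.sqrt d * (1 / Real.sqrt d) :=
          mul_le_mul_of_nonneg_left (min_le_right _ _) hsqrt.le
      _ = 1 := by field_simp
  have hL0 : 0 ≤ L := le_trans (div_nonneg (Real.log_nonneg (by linarith)) (by norm_num)) hLd
  have hA0 : 0 ≤ d * L := by positivity
  -- If b L ≥ 6, then 6d is absorbed by b d L. Otherwise L is bounded, so d ≤ D; then either b B
  -- dominates 6d, or B is bounded and the right-hand side is at least 1.
  rcases le_or_gt 6 (b * L) with hbig | hsmall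
  · rcases le_or_gt B (d * L) with hAB | hAB
    · have : 1 ≤ Real.exp (c * (d * L - B)) :=
        Real.one_le_exp (mul_nonneg hc0.le (by linarith))
      linarith
    · refine hP.trans ?_
      have h1 : b * (d * L - B) ≤ c * (d * L - B) :=
        mul_le_mul_of_nonpos_right (by linarith) (by linarith)
      have h2 : 6 * (d : ℝ) ≤ b * (d * L) := by nlinarith
      have h3 : Real.exp (6 * d - b * B) ≤ Real.exp (c * (d * L - B)) :=
        Real.exp_le_exp.2 (by linarith)
      linarith
  · have hdD : (d : ℝ) ≤ D := by
      rw [hD, ← Real.log_le_iff_le_exp (by linarith)]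
      have : L ≤ 6 / b := by rw [le_div_iff₀ hb]; linarith
      have h2 : 12 / b = 2 * (6 / b) := by ring
      linarith
    have hcA : 0 ≤ c * (d * L) := by positivity
    rcases le_or_gt (12 * D) (b * B) with hB1 | hB1
    · refine hP.trans ?_
      have h1 : c * B ≤ b / 2 * B := mul_le_mul_of_nonneg_right hcb hB
      have h3 : Real.exp (6 * d - b * B) ≤ Real.exp (c * (d * L - B)) :=
        Real.exp_le_exp.2 (by linarith)
      linarith
    · have h1 : c * B ≤ 1 / 2 := by
        refine (mul_le_mul_of_nonneg_right hcD hB).trans ?_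
        rw [div_mul_eq_mul_div, div_le_iff₀ (by positivity)]
        linarith
      have h2 := Real.add_one_le_exp (c * (d * L - B))
      linarith

end RandomPolyhedron

theorem theorem1 :
    ∃ c : ℝ, 0 < c ∧
      ∀ (d N : ℕ), 2 ≤ d → 1 ≤ N →
      ∀ (Ω : Type*) [MeasurableSpace Ω] (μ : Measure Ω) [IsProbabilityMeasure μ]
        (p : Fin N → Ω → Metric.sphere (0 : EuclideanSpace ℝ (Fin d)) 1),
        (∀ i, HasLaw (p i) (uniformSphere d) μ) → iIndepFun p μ →
      ∀ u : EuclideanSpace ℝ (Fin d), ‖u‖ = 1 →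
      ∀ η : ℝ, 0 < η →
        1 - 2 * Real.exp
            (c * (d * Real.log (1 / min η (1 / Real.sqrt d)) - N * η ^ 2)) ≤
          μ.real {ω |
            Metric.hausdorffEDist
              ((sphereMeanAbs d u)⁻¹ •
                symHalvingPolyhedron N
                  (Set.range fun i => (p i ω : EuclideanSpace ℝ (Fin d))))
              (Metric.closedBall 0 1) ≤ ENNReal.ofReal η} := by
  have hb : 0 < gaussianMeanAbs ^ 2 / 2048 := by have := gaussianMeanAbs_pos; positivity
  obtain ⟨c, hc0, hc⟩ := exists_common_constant hb
  refine ⟨c, hc0, fun d N hd hN Ω _ μ _ p hp hind u hu η hη => ?_⟩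
  have hd1 : 1 ≤ d := by omega
  have hN' : (N : ℝ) ≠ 0 := by exact_mod_cast (show N ≠ 0 by omega)
  have hm := sphereMeanAbs_pos hd1 hu
  set A := {ω | Metric.hausdorffEDist ((sphereMeanAbs d u)⁻¹ • symHalvingPolyhedron N
    (Set.range fun i => (p i ω : EuclideanSpace ℝ (Fin d)))) (Metric.closedBall 0 1) ≤
      ENNReal.ofReal η} with hA
  set dev := {ω | ∃ v : EuclideanSpace ℝ (Fin d), ‖v‖ ≤ 1 ∧ N * η <
    |∑ i, (|⟪(p i ω : EuclideanSpace ℝ (Fin d)), v⟫| / sphereMeanAbs d u - ‖v‖)|} with hdev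
  have hbound := hc d (N * η ^ 2) η (μ.real dev) hd (by positivity) hη measureReal_le_one
    (measure_sum_abs_inner_deviation_le hd1 hN hp hind hu hη)
  have hcover : ∀ᵐ ω ∂μ, ω ∈ A ∪ dev := by
    filter_upwards [ae_forall_ne_and_ne_neg hd hp hind] with ω hω
    by_cases hωdev : ω ∈ dev
    · exact Or.inr hωdev
    refine Or.inl (hausdorffEDist_symHalvingPolyhedron_le (fun i j hij => ?_) hm hη.le
      fun v hv => ?_)
    · exact ⟨fun h => (hω i j hij).1 (Subtype.ext h), fun h => (hω i j hij).2 (Subtype.ext h)⟩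
    · have h1 : |∑ i, (|⟪(p i ω : EuclideanSpace ℝ (Fin d)), v⟫| / sphereMeanAbs d u - ‖v‖)| ≤
          N * η := by
        by_contra! h
        exact hωdev ⟨v, hv.le, h⟩
      have h2 : (sphereMeanAbs d u)⁻¹ *
          ((N : ℝ)⁻¹ * ∑ i, |⟪(p i ω : EuclideanSpace ℝ (Fin d)), v⟫|) - 1 =
          (N : ℝ)⁻¹ *
            ∑ i, (|⟪(p i ω : EuclideanSpace ℝ (Fin d)), v⟫| / sphereMeanAbs d u - ‖v‖) := by
        rw [Finset.sum_sub_distrib, ← Finset.sum_div, hv, Finset.sum_const, Finset.card_univ,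
          Fintype.card_fin, nsmul_eq_mul, mul_one, mul_sub, inv_mul_cancel₀ hN']
        ring
      rw [h2, abs_mul, abs_of_nonneg (by positivity : (0 : ℝ) ≤ (N : ℝ)⁻¹)]
      calc (N : ℝ)⁻¹ * _ ≤ (N : ℝ)⁻¹ * (N * η) := mul_le_mul_of_nonneg_left h1 (by positivity)
        _ = η := by rw [← mul_assoc, inv_mul_cancel₀ hN', one_mul]
  -- Subadditivity suffices, so neither event has to be measurable.
  have hone : 1 ≤ μ.real A + μ.real dev := by
    refine le_trans (le_of_eq ?_) (measureReal_union_le A dev)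
    have huniv : (A ∪ dev : Set Ω) =ᵐ[μ] Set.univ := Filter.eventuallyEq_univ.2 hcover
    rw [measureReal_congr huniv, probReal_univ]
  linarith
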